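/- We work over $\mathbb{C}$. Let $(V,Y,\mathbf 1,\omega)$ be a vertex operator algebra: $V=\bigoplus_{n\in\mathbb Z}V_n$ with $V_n=\{v\mid L(0)v=nv\}$ finite dimensional and $V_n=0$ for $n\ll 0$. Write $Y(u,z)=\sum_{n\in\mathbb Z}u_nz^{-n-1}$ and $Y(\omega,z)=\sum_{n\in\mathbb Z}L(n)z^{-n-2}$. Let $H$ be a Hopf algebra with comultiplication $\Delta(h)=\sum h_1\otimes h_2$ and counit $\varepsilon$. Suppose that $V$ is an $H$-module VOA, that is, $V$ is an $H$-module with $h\omega=\varepsilon(h)\omega$ and $hY(u,z)v=\sum Y(h_1u,z)h_2v$ for all $h\in H$ and $u,v\in V$. Suppose moreover that $V$ is a simple VOA (i.e. simple as a module over itself) and a semisimple $H$-module. Let $\{M_i\mid i\in I\}$ be a complete set of representatives of the isomorphism classes of simple $H$-modules occurring in $V$ (as submodules), and let $V_{M_i}=\operatorname{Hom}_H(M_i,V)$ be the multiplicity space of $M_i$ in $V$. Let $V^H=\{v\in V\mid hv=\varepsilon(h)v\ \text{for all } h\in H\}$, with the restriction of $Y$ and with the same $\mathbf 1$ and $\omega$.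 The modes of elements of $V^H$ commute with $H$, so they act on $V_{M_i}$ by $(u_nf)(x)=u_n(f(x))$ for $u\in V^H$, $f\in V_{M_i}$, $x\in M_i$. Then: * The canonical map $\bigoplus_{i\in I}M_i\otimes V_{M_i}\to V$, $x\otimes f\mapsto f(x)$, is bijective. * (i) $V^H$ is a simple VOA, and each $V_{M_i}$ is a simple $V^H$-module. * (ii) For $i,j\in I$, $V_{M_i}$ and $V_{M_j}$ are isomorphic as $V^H$-modules if and only if $i=j$. Here a $V^H$-module is an ordinary module: it satisfies truncation, the vacuum property and the Jacobi identity, and it is the direct sum of the eigenspaces $M_\lambda$ ($\lambda\in\mathbb C$) of $L(0)$, with every $M_\lambda$ finite dimensional and, for each fixed $\lambda$, $M_{\lambda+n}=0$ for all sufficiently small integers $n$. It is simple if it is nonzero and has no submodules other than $0$ and itself. -/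

import Mathlib

open scoped TensorProduct DirectSum

noncomputable section

/-- The data `(Y, 𝟏, ω)` underlying a vertex operator algebra on a complex vector space `V`.
The formal series `Y(u, z) = ∑ₙ uₙ z^{-n-1}` in `End(V)[[z, z⁻¹]]`, linear in `u`, is given by its
coefficients: `mode n u` is the endomorphism `uₙ`. -/
structure VOAData (V : Type*) [AddCommGroup V] [Module ℂ V] where
  mode : ℤ → V →ₗ[ℂ] V →ₗ[ℂ] V
  vac : V
  conf : V

namespace VOAData

section Basic

variable {V : Type*} [AddCommGroup V] [Module ℂ V] (A : VOAData V)
variable {M : Type*} [AddCommGroup M] [Module ℂ M] {N : Type*} [AddCommGroup N] [Module ℂ N]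

/-- Truncation: for all `u`, `w` one has `uₙ w = 0` for `n ≫ 0`. -/
def Truncated (act : ℤ → V →ₗ[ℂ] M →ₗ[ℂ] M) : Prop :=
  ∀ (u : V) (w : M), ∃ K : ℤ, ∀ n : ℤ, K ≤ n → act n u w = 0

/-- The Jacobi identity for the action `act` of `A` on `M`: the equality of the coefficients of
`z₀^{-l-1} z₁^{-m-1} z₂^{-n-1}` on the two sides of
`z₀⁻¹ δ((z₁-z₂)/z₀) Y(u,z₁) Y(v,z₂) w - z₀⁻¹ δ((-z₂+z₁)/z₀) Y(v,z₂) Y(u,z₁) w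
  = z₁⁻¹ δ((z₂+z₀)/z₁) Y(Y(u,z₀)v,z₂) w`, for all integers `l`, `m`, `n`.
It is only used together with truncation, which makes each of the sums finite. -/
def Jacobi (act : ℤ → V →ₗ[ℂ] M →ₗ[ℂ] M) : Prop :=
  ∀ (u v : V) (w : M) (l m n : ℤ),
    (∑ᶠ i : ℕ, ((-1 : ℂ) ^ i * (Ring.choose l i : ℤ)) •
        act (m + l - i) u (act (n + i) v w))
      - (∑ᶠ i : ℕ, ((-1 : ℂ) ^ (l + i) * (Ring.choose l i : ℤ)) •
        act (n + l - i) v (act (m + i) u w))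
    = ∑ᶠ i : ℕ, ((Ring.choose m i : ℤ) : ℂ) • act (m + n - i) (A.mode (l + i) u v) w

/-- The Virasoro operator `L(n) = ω_{n+1}` on `M`. -/
def L (act : ℤ → V →ₗ[ℂ] M →ₗ[ℂ] M) (n : ℤ) : Module.End ℂ M := act (n + 1) A.conf

/-- The weight space `M_μ = {w | L(0) w = μ w}`. -/
def weightSpace (act : ℤ → V →ₗ[ℂ] M →ₗ[ℂ] M) (μ : ℂ) : Submodule ℂ M :=
  (A.L act 0).eigenspace μ

/-- `(V, Y, 𝟏, ω)` is a vertex operator algebra. The `ℤ`-grading of `V` is the one by the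
eigenspaces `V_n` of `L(0)`. -/
structure IsVOA : Prop where
  grading : DirectSum.IsInternal (fun n : ℤ => A.weightSpace A.mode (n : ℂ))
  finite_dim : ∀ n : ℤ, FiniteDimensional ℂ (A.weightSpace A.mode (n : ℂ))
  bounded_below : ∃ K : ℤ, ∀ n : ℤ, n < K → A.weightSpace A.mode (n : ℂ) = ⊥
  vac_mem : A.vac ∈ A.weightSpace A.mode 0
  conf_mem : A.conf ∈ A.weightSpace A.mode 2
  truncated : Truncated A.mode
  vac_mode : ∀ (n : ℤ) (v : V), A.mode n A.vac v = if n = -1 then v else 0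
  creation : ∀ v : V, A.mode (-1) v A.vac = v
  creation_nonneg : ∀ (n : ℤ) (v : V), 0 ≤ n → A.mode n v A.vac = 0
  /-- `Y(L(-1)v, z) = d/dz Y(v, z)` -/
  derivative : ∀ (n : ℤ) (v : V), A.mode n (A.L A.mode (-1) v) = (-n : ℂ) • A.mode (n - 1) v
  virasoro : ∃ c : ℂ, ∀ m n : ℤ,
    A.L A.mode m * A.L A.mode n - A.L A.mode n * A.L A.mode m
      = ((m : ℂ) - n) • A.L A.mode (m + n)
        + (if m + n = 0 then ((m : ℂ) ^ 3 - m) / 12 * c else 0) • (1 : Module.End ℂ V)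
  jacobi : A.Jacobi A.mode

/-- `M` with the action `Y_M(u, z) = ∑ₙ (act n u) z^{-n-1}` is an (ordinary) `V`-module: a weak
module which is the direct sum of the eigenspaces `M_μ` (`μ ∈ ℂ`) of `L(0)`, these being finite
dimensional, with `M_{μ+n} = 0` for each fixed `μ` and all sufficiently small integers `n`. -/
structure IsVMod (act : ℤ → V →ₗ[ℂ] M →ₗ[ℂ] M) : Prop where
  truncated : Truncated act
  vac_mode : ∀ (n : ℤ) (w : M), act n A.vac w = if n = -1 then w else 0
  jacobi : A.Jacobi act
  grading : DirectSum.IsInternal (fun μ : ℂ => A.weightSpace act μ)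
  finite_dim : ∀ μ : ℂ, FiniteDimensional ℂ (A.weightSpace act μ)
  bounded_below : ∀ μ : ℂ, ∃ K : ℤ, ∀ n : ℤ, n < K → A.weightSpace act (μ + n) = ⊥

/-- The action of `V` on `M` is irreducible: `M ≠ 0`, and `0` and `M` are the only subspaces stable
under all `uₙ`. (A stable subspace of a module is a submodule: `L(0) = ω₁` acts on it.) -/
def IsIrreducible (act : ℤ → V →ₗ[ℂ] M →ₗ[ℂ] M) : Prop :=
  Nontrivial M ∧ ∀ W : Submodule ℂ M,
    (∀ (n : ℤ) (u : V), ∀ w ∈ W, act n u w ∈ W) → W = ⊥ ∨ W = ⊤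

/-- `M` and `N` are isomorphic `V`-modules. -/
def ModIso (act : ℤ → V →ₗ[ℂ] M →ₗ[ℂ] M) (act' : ℤ → V →ₗ[ℂ] N →ₗ[ℂ] N) : Prop :=
  ∃ e : M ≃ₗ[ℂ] N, ∀ (n : ℤ) (u : V) (w : M), e (act n u w) = act' n u (e w)

/-- A simple vertex operator algebra: one that is simple as a module over itself. -/
structure IsSimpleVOA : Prop where
  isVOA : A.IsVOA
  irreducible : IsIrreducible A.mode

end Basic

section Hopf

variable {V : Type*} [AddCommGroup V] [Module ℂ V] (A : VOAData V)
variable (H : Type*) [Ring H] [HopfAlgebra ℂ H] [Module H V] [IsScalarTower ℂ H V]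

/-- The linear map `H → V`, `h ↦ h v`. -/
def orbitMap (v : V) : H →ₗ[ℂ] V := (LinearMap.toSpanSingleton H V v).restrictScalars ℂ

/-- `V` is an `H`-module VOA (for the given `H`-module structure on `V`): `h ω = ε(h) ω` and
`h (uₙ v) = ∑ (h₁ u)ₙ (h₂ v)` where `Δ(h) = ∑ h₁ ⊗ h₂`. -/
structure IsHopfModule : Prop where
  smul_conf : ∀ h : H, h • A.conf = Coalgebra.counit (R := ℂ) h • A.conf
  smul_mode : ∀ (h : H) (n : ℤ) (u v : V), h • A.mode n u v =
    TensorProduct.lift ((A.mode n).compl₁₂ (orbitMap H u) (orbitMap H v))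
      (Coalgebra.comul (R := ℂ) h)

variable (V) in
/-- The space of invariants `V^H = {v | h v = ε(h) v for all h ∈ H}`. -/
def invariants : Submodule ℂ V where
  carrier := {v | ∀ h : H, h • v = Coalgebra.counit (R := ℂ) h • v}
  add_mem' := fun ha hb h => by rw [smul_add, smul_add, ha h, hb h]
  zero_mem' := fun h => by simp
  smul_mem' := fun c v hv h => by rw [smul_comm h c v, hv h, smul_comm]

variable {A H}

/-- Modes of invariant vectors commute with `H`. -/
theorem IsHopfModule.smul_mode_invariant (hH : A.IsHopfModule H) {u : V}
    (hu : u ∈ invariants V H) (h : H) (n : ℤ) (v : V) :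
    h • A.mode n u v = A.mode n u (h • v) := by
  rw [hH.smul_mode]
  have key : TensorProduct.lift ((A.mode n).compl₁₂ (orbitMap H u) (orbitMap H v))
      = (A.mode n u ∘ₗ orbitMap H v) ∘ₗ (TensorProduct.lid ℂ H).toLinearMap ∘ₗ
        (Coalgebra.counit (R := ℂ) (A := H)).rTensor H := by
    ext a b
    have ha := hu a
    simp only [orbitMap] at *
    simp [ha]
  rw [key]
  simp [orbitMap]

theorem IsHopfModule.mode_mem_invariants (hH : A.IsHopfModule H) {u v : V}
    (hu : u ∈ invariants V H) (hv : v ∈ invariants V H) (n : ℤ) :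
    A.mode n u v ∈ invariants V H := fun h => by
  rw [hH.smul_mode_invariant hu, hv h, map_smul]

/-- The vacuum is invariant: `h 𝟏 = ε(h) 𝟏`. -/
theorem IsHopfModule.vac_mem_invariants (hH : A.IsHopfModule H) (hA : A.IsVOA) :
    A.vac ∈ invariants V H := fun h => by
  set B : H ⊗[ℂ] H →ₗ[ℂ] V :=
    TensorProduct.lift ((A.mode (-1)).compl₁₂ (orbitMap H A.vac) (orbitMap H A.vac)) with hB
  have h1 : orbitMap H A.vac ∘ₗ LinearMap.mul' ℂ H =
      B ∘ₗ (LinearMap.mul' ℂ H).lTensor H ∘ₗ (TensorProduct.assoc ℂ H H H).toLinearMap ∘ₗ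
        (Coalgebra.comul (R := ℂ) (A := H)).rTensor H := by
    ext a b
    have e1 : (a * b) • A.vac = a • A.mode (-1) A.vac (b • A.vac) := by
      rw [hA.vac_mode, if_pos rfl, mul_smul]
    have e2 : TensorProduct.lift
        ((A.mode (-1)).compl₁₂ (orbitMap H A.vac) (orbitMap H (b • A.vac)))
        = B ∘ₗ (LinearMap.mul' ℂ H).lTensor H ∘ₗ (TensorProduct.assoc ℂ H H H).toLinearMap ∘ₗ
          (TensorProduct.mk ℂ (H ⊗[ℂ] H) H).flip b := by
      ext x y
      simp [hB, orbitMap, mul_smul]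
    have e3 := LinearMap.congr_fun e2 (Coalgebra.comul (R := ℂ) a)
    rw [← hH.smul_mode, ← e1] at e3
    simpa [orbitMap] using e3
  have h2 := LinearMap.congr_fun h1
    ((HopfAlgebra.antipode ℂ (A := H)).lTensor H (Coalgebra.comul h))
  have h3 : (TensorProduct.assoc ℂ H H H).toLinearMap ∘ₗ
        (Coalgebra.comul (R := ℂ) (A := H)).rTensor H ∘ₗ (HopfAlgebra.antipode ℂ (A := H)).lTensor H
      = ((HopfAlgebra.antipode ℂ (A := H)).lTensor H).lTensor H ∘ₗ
        (TensorProduct.assoc ℂ H H H).toLinearMap ∘ₗ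
          (Coalgebra.comul (R := ℂ) (A := H)).rTensor H := by
    ext a b
    have e : ∀ x : H ⊗[ℂ] H,
        TensorProduct.assoc ℂ H H H (x ⊗ₜ[ℂ] HopfAlgebra.antipode ℂ b) =
          ((HopfAlgebra.antipode ℂ (A := H)).lTensor H).lTensor H
            (TensorProduct.assoc ℂ H H H (x ⊗ₜ[ℂ] b)) := fun x => by
      induction x with
      | zero => simp
      | tmul x y => simp
      | add x y hx hy => simp only [TensorProduct.add_tmul, map_add, hx, hy]
    simpa using e _
  have h4 := LinearMap.congr_fun h3 (Coalgebra.comul h)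
  simp only [LinearMap.comp_apply, LinearEquiv.coe_coe, Coalgebra.coassoc_apply] at h2 h4
  rw [h4, HopfAlgebra.mul_antipode_lTensor_comul_apply] at h2
  rw [← LinearMap.lTensor_comp_apply, ← LinearMap.lTensor_comp_apply, LinearMap.comp_assoc,
    HopfAlgebra.mul_antipode_lTensor_comul, LinearMap.lTensor_comp_apply] at h2
  rw [Coalgebra.lTensor_counit_comul] at h2
  simpa [hB, orbitMap, hA.creation, Algebra.algebraMap_eq_smul_one] using h2.symm

variable (A H)

/-- `V^H` with the restriction of `Y` and with the vacuum and the conformal vector of `V`. -/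
def fixedVOA (hA : A.IsVOA) (hH : A.IsHopfModule H) : VOAData (invariants V H) where
  mode n := LinearMap.mk₂ ℂ (fun u v => ⟨A.mode n u v, hH.mode_mem_invariants u.2 v.2 n⟩)
    (fun _ _ _ => by ext; simp) (fun _ _ _ => by ext; simp)
    (fun _ _ _ => by ext; simp) (fun _ _ _ => by ext; simp)
  vac := ⟨A.vac, hH.vac_mem_invariants hA⟩
  conf := ⟨A.conf, hH.smul_conf⟩

variable {H}
variable (M : Type*) [AddCommGroup M] [Module H M]

/-- The action of `V^H` on the multiplicity space `V_M = Hom_H(M, V)` of the `H`-module `M` in `V`: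
`(uₙ f)(x) = uₙ (f x)`. -/
def multAct (hH : A.IsHopfModule H) (n : ℤ) :
    invariants V H →ₗ[ℂ] (M →ₗ[H] V) →ₗ[ℂ] (M →ₗ[H] V) :=
  LinearMap.mk₂ ℂ
    (fun u f =>
      { toFun := fun x => A.mode n (u : V) (f x)
        map_add' := fun x y => by simp
        map_smul' := fun h x => by
          rw [map_smul, RingHom.id_apply, hH.smul_mode_invariant u.2] })
    (fun _ _ _ => by ext; simp) (fun _ _ _ => by ext; simp)
    (fun _ _ _ => by ext; simp) (fun _ _ _ => by ext; simp)

/-- `(M i)` is a complete family of representatives of the isomorphism classes of the simple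
`H`-modules occurring in `V`: the `M i` are simple, each is isomorphic to a submodule of `V`, they
are pairwise non-isomorphic, and each simple submodule of `V` is isomorphic to one of them. -/
structure IsSimpleFamily (H V : Type*) [Ring H] [AddCommGroup V] [Module H V]
    {I : Type*} (M : I → Type*) [∀ i, AddCommGroup (M i)] [∀ i, Module H (M i)] : Prop where
  simple : ∀ i, IsSimpleModule H (M i)
  occurs : ∀ i, ∃ f : M i →ₗ[H] V, Function.Injective f
  inequivalent : ∀ i j, Nonempty (M i ≃ₗ[H] M j) → i = j
  complete : ∀ S : Submodule H V, IsSimpleModule H S → ∃ i, Nonempty (S ≃ₗ[H] M i)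

open Classical in
/-- The canonical map `⨁ᵢ Mᵢ ⊗ V_{Mᵢ} → V`, `x ⊗ f ↦ f x`. It intertwines the action of `H` on the
first tensor factors and of `V^H` on the second ones with their actions on `V`. -/
def decompMap (H V : Type*) [Ring H] [HopfAlgebra ℂ H] [AddCommGroup V] [Module ℂ V] [Module H V]
    [IsScalarTower ℂ H V] {I : Type*} (M : I → Type*) [∀ i, AddCommGroup (M i)]
    [∀ i, Module ℂ (M i)] [∀ i, Module H (M i)] [∀ i, IsScalarTower ℂ H (M i)] :
    (⨁ i, M i ⊗[ℂ] (M i →ₗ[H] V)) →ₗ[ℂ] V :=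
  DirectSum.toModule ℂ I V fun i => TensorProduct.lift
    (LinearMap.mk₂ ℂ (fun (x : M i) (f : M i →ₗ[H] V) => f x)
      (fun x y f => map_add f x y)
      (fun c x f => (f.restrictScalars ℂ).map_smul c x)
      (fun _ _ _ => rfl) (fun _ _ _ => rfl))

end Hopf

end VOAData

end

/-! The engine is a density theorem: for a simple VOA, every linear map from a finite dimensional
subspace `W` to `V` is a finite sum of modes restricted to `W` (`IsSimpleVOA.modeSpan_eq_top`). By
the Jacobi identity, a product of two modes agrees on `W` with a combination of modes, so modes span
on `W` the whole algebra they generate. By Schur's lemma that algebra has only scalars as commutant,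
and Jacobson density applies.

If `W` is an `H`-submodule and the map is `H`-linear, the modes can be taken from invariant vectors
(`IsHopfModule.exists_invariant_modes`). For fixed indices `n j`, the map from tuples `v` to the
restriction of `∑ j, A.mode (n j) (v j)` to `W` intertwines `H` with its action `ψ ↦ ∑ h₁ ψ S(h₂)`
on linear maps. An `H`-linear map is invariant for this action, and semisimplicity of `V` lifts it
to an invariant tuple.

Simple `H`-modules in `V` embed in a weight space, hence are finite dimensional. Invariant modes
therefore carry any nonzero `f : M →ₗ[H] V` to any other, which gives simplicity of the multiplicity
spaces; for non-isomorphic `M` and `N` they can fix `f` and kill a given nonzero map from `N`, which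
separates the two. Bijectivity of the canonical map is the isotypic decomposition together with
density over `H`. -/

noncomputable section

namespace VOAData

/-! ### Density of the modes of a simple VOA -/

section Density

variable {V : Type*} [AddCommGroup V] [Module ℂ V] (A : VOAData V)

/-- The span of the restrictions of the modes `uₙ` to a subspace `W`. -/
def modeSpan (W : Submodule ℂ V) : Submodule ℂ (W →ₗ[ℂ] V) :=
  Submodule.span ℂ (Set.range fun p : ℤ × V => A.mode p.1 p.2 ∘ₗ W.subtype)

variable {A}

theorem mode_mem_modeSpan (W : Submodule ℂ V) (n : ℤ) (u : V) :
    A.mode n u ∘ₗ W.subtype ∈ A.modeSpan W :=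
  Submodule.subset_span ⟨(n, u), rfl⟩

/-- A finite spanning set makes the truncation bound uniform on `W`. -/
theorem IsVOA.exists_truncation (hA : A.IsVOA) (W : Submodule ℂ V) [FiniteDimensional ℂ W]
    (u : V) : ∃ K : ℤ, ∀ n : ℤ, K ≤ n → ∀ w ∈ W, A.mode n u w = 0 := by
  obtain ⟨s, hs⟩ := (Submodule.fg_iff_finiteDimensional W).2 ‹_›
  choose K hK using fun w => hA.truncated u w
  obtain ⟨B, hB⟩ := (s.image K).bddAbove
  refine ⟨B, fun n hn w hw => ?_⟩
  rw [← hs] at hw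
  have hle : Submodule.span ℂ (s : Set V) ≤ LinearMap.ker (A.mode n u) :=
    Submodule.span_le.2 fun x hx => hK x n
      ((hB (Finset.mem_coe.2 (Finset.mem_image_of_mem K hx))).trans hn)
  exact hle hw

theorem finsum_nat_eq_sum_range {E : Type*} [AddCommMonoid E] {f : ℕ → E} {N : ℕ}
    (hf : ∀ i, N ≤ i → f i = 0) : ∑ᶠ i, f i = ∑ i ∈ Finset.range N, f i := by
  refine finsum_eq_sum_of_support_subset _ fun i hi => ?_
  simp only [Finset.coe_range, Set.mem_Iio]
  by_contra h
  exact hi (hf i (not_lt.1 h))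

/-- On a finite dimensional subspace, a product of two modes is a combination of modes. -/
theorem IsVOA.mode_comp_mode_mem (hA : A.IsVOA) (W : Submodule ℂ V) [FiniteDimensional ℂ W]
    (u v : V) (p q : ℤ) : A.mode p u ∘ₗ A.mode q v ∘ₗ W.subtype ∈ A.modeSpan W := by
  obtain ⟨Ku, hKu⟩ := hA.exists_truncation W u
  obtain ⟨Kv, hKv⟩ := hA.exists_truncation W v
  obtain ⟨K, hK⟩ := hA.truncated u v
  -- Induction on the distance from `q` up to `Kv`, beyond which the modes of `v` vanish on `W`.
  obtain ⟨d, hd⟩ : ∃ d : ℕ, Kv - q ≤ d := ⟨(Kv - q).toNat, Int.self_le_toNat _⟩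
  induction d generalizing p q with
  | zero =>
    have h0 : A.mode p u ∘ₗ A.mode q v ∘ₗ W.subtype = 0 := by
      ext w
      simp [hKv q (by simpa using hd) w w.2]
    rw [h0]
    exact zero_mem _
  | succ d ih =>
    -- In the Jacobi identity with `m = Ku`, `n = q`, the second sum vanishes on `W`. This `l` makes
    -- the leading term of the first sum the product wanted; its other terms have a higher mode of
    -- `v`, and the right side consists of single modes.
    set l := p - Ku with hl
    set N := d + 1 + (K - l).toNat with hN
    have hNK : (K - l) ≤ N := by have := Int.self_le_toNat (K - l); push_cast [hN]; omega
    have key : A.mode p u ∘ₗ A.mode q v ∘ₗ W.subtype =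
        ∑ i ∈ Finset.range (N + 1), ((Ring.choose Ku i : ℤ) : ℂ) •
          (A.mode (Ku + q - i) (A.mode (l + i) u v) ∘ₗ W.subtype)
        - ∑ i ∈ Finset.range N, ((-1 : ℂ) ^ (i + 1) * (Ring.choose l (i + 1) : ℤ)) •
          (A.mode (p - (i + 1 : ℤ)) u ∘ₗ A.mode (q + (i + 1 : ℤ)) v ∘ₗ W.subtype) := by
      ext w
      have hj := hA.jacobi u v w l Ku q
      rw [finsum_nat_eq_sum_range (N := N + 1), finsum_nat_eq_sum_range (N := 0),
        finsum_nat_eq_sum_range (N := N + 1), Finset.sum_range_succ'] at hj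
      · simp only [Finset.range_zero, Finset.sum_empty, sub_zero, pow_zero, Ring.choose_zero_right,
          Nat.cast_zero, add_zero, Int.cast_one, mul_one, one_smul,
          show Ku + l = p by omega, Nat.cast_add, Nat.cast_one] at hj
        simp only [LinearMap.comp_apply, LinearMap.sub_apply, LinearMap.sum_apply,
          LinearMap.smul_apply, Submodule.subtype_apply, ← hj]
        abel
      · intro i hi
        rw [hK _ (by omega)]
        simp
      · intro i _
        rw [hKu _ (by omega) w w.2]
        simp
      · intro i hi
        rw [hKv _ (by omega) w w.2]
        simp
    rw [key]
    refine sub_mem (sum_mem fun i _ => Submodule.smul_mem _ _ (mode_mem_modeSpan W _ _))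
      (sum_mem fun i _ => Submodule.smul_mem _ _ (ih _ _ ?_))
    push_cast at hd
    omega

theorem IsVOA.mode_comp_mem (hA : A.IsVOA) (W : Submodule ℂ V) [FiniteDimensional ℂ W]
    (n : ℤ) (u : V) {φ : W →ₗ[ℂ] V} (hφ : φ ∈ A.modeSpan W) :
    A.mode n u ∘ₗ φ ∈ A.modeSpan W := by
  induction hφ using Submodule.span_induction with
  | mem x hx =>
    obtain ⟨⟨m, v⟩, rfl⟩ := hx
    exact hA.mode_comp_mode_mem W u v n m
  | zero => simp
  | add x y _ _ hx hy => rw [LinearMap.comp_add]; exact add_mem hx hy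
  | smul c x _ hx => rw [LinearMap.comp_smul]; exact Submodule.smul_mem _ _ hx

variable (A) in
/-- The associative algebra generated by all modes. -/
def modeAlgebra : Subalgebra ℂ (Module.End ℂ V) :=
  Algebra.adjoin ℂ (Set.range fun p : ℤ × V => A.mode p.1 p.2)

variable (A) in
theorem mode_mem_modeAlgebra (n : ℤ) (u : V) : A.mode n u ∈ A.modeAlgebra :=
  Algebra.subset_adjoin ⟨(n, u), rfl⟩

theorem IsVOA.modeAlgebra_comp_mem (hA : A.IsVOA) (W : Submodule ℂ V) [FiniteDimensional ℂ W]
    {b : Module.End ℂ V} (hb : b ∈ A.modeAlgebra) :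
    ∀ φ ∈ A.modeSpan W, b ∘ₗ φ ∈ A.modeSpan W := by
  induction hb using Algebra.adjoin_induction with
  | mem x hx =>
    obtain ⟨⟨m, v⟩, rfl⟩ := hx
    exact fun φ hφ => hA.mode_comp_mem W m v hφ
  | algebraMap r =>
    intro φ hφ
    have : (algebraMap ℂ (Module.End ℂ V) r) ∘ₗ φ = r • φ := by ext; simp
    rw [this]
    exact Submodule.smul_mem _ _ hφ
  | add x y _ _ hx hy =>
    intro φ hφ
    rw [LinearMap.add_comp]
    exact add_mem (hx φ hφ) (hy φ hφ)
  | mul x y _ _ hx hy =>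
    intro φ hφ
    exact hx _ (hy φ hφ)

theorem IsVOA.subtype_mem_modeSpan (hA : A.IsVOA) (W : Submodule ℂ V) :
    W.subtype ∈ A.modeSpan W := by
  have : W.subtype = A.mode (-1) A.vac ∘ₗ W.subtype := by
    ext w
    simp [hA.vac_mode]
  rw [this]
  exact mode_mem_modeSpan W _ _

theorem IsSimpleVOA.isSimpleModule (hA : A.IsSimpleVOA) : IsSimpleModule A.modeAlgebra V := by
  have := hA.irreducible.1
  refine { eq_bot_or_eq_top := fun W => ?_ }
  rcases hA.irreducible.2 (W.restrictScalars ℂ) fun n u w hw =>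
    W.smul_mem (⟨A.mode n u, A.mode_mem_modeAlgebra n u⟩ : A.modeAlgebra) hw with h | h
  · exact Or.inl ((Submodule.restrictScalars_eq_bot_iff _ _ _).1 h)
  · exact Or.inr ((Submodule.restrictScalars_eq_top_iff _ _ _).1 h)

/-- Schur's lemma for a simple vertex operator algebra. -/
theorem IsSimpleVOA.exists_smul_eq (hA : A.IsSimpleVOA) (T : Module.End A.modeAlgebra V) :
    ∃ c : ℂ, ∀ v, T v = c • v := by
  have := hA.irreducible.1
  have := hA.isSimpleModule
  -- `T` commutes with `L(0)`, so it preserves a nonzero finite dimensional weight space and has an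
  -- eigenvalue there. The corresponding kernel is a nonzero submodule, hence everything.
  obtain ⟨n, hn⟩ : ∃ n : ℤ, A.weightSpace A.mode (n : ℂ) ≠ ⊥ := by
    by_contra! h
    have h1 := hA.isVOA.grading.submodule_iSup_eq_top
    simp [h] at h1
  have hmaps : ∀ v ∈ A.weightSpace A.mode (n : ℂ),
      (T.restrictScalars ℂ) v ∈ A.weightSpace A.mode (n : ℂ) := by
    intro v hv
    rw [weightSpace, Module.End.mem_eigenspace_iff] at hv ⊢
    have h1 := T.map_smul (⟨A.mode (0 + 1) A.conf, A.mode_mem_modeAlgebra _ _⟩ : A.modeAlgebra) v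
    have h2 : T (A.L A.mode 0 v) = A.L A.mode 0 (T v) := h1
    rw [LinearMap.restrictScalars_apply, ← h2, hv]
    exact (T.restrictScalars ℂ).map_smul _ _
  have := hA.isVOA.finite_dim n
  have : Nontrivial (A.weightSpace A.mode (n : ℂ)) := Submodule.nontrivial_iff_ne_bot.2 hn
  obtain ⟨c, hc⟩ := Module.End.exists_eigenvalue ((T.restrictScalars ℂ).restrict hmaps)
  obtain ⟨w, hw⟩ := hc.exists_hasEigenvector
  refine ⟨c, fun v => ?_⟩
  have hker : LinearMap.ker (T - algebraMap ℂ (Module.End A.modeAlgebra V) c) ≠ ⊥ := by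
    intro h
    have hw' : (w : V) ∈ LinearMap.ker (T - algebraMap ℂ (Module.End A.modeAlgebra V) c) := by
      have h3 := congrArg Subtype.val hw.apply_eq_smul
      simpa [sub_eq_zero] using h3
    rw [h, Submodule.mem_bot] at hw'
    exact hw.2 (Subtype.ext hw')
  have htop := (eq_bot_or_eq_top (LinearMap.ker
    (T - algebraMap ℂ (Module.End A.modeAlgebra V) c))).resolve_left hker
  have hv : v ∈ LinearMap.ker (T - algebraMap ℂ (Module.End A.modeAlgebra V) c) := htop ▸ trivial
  simpa [sub_eq_zero] using hv

/-- In a simple vertex operator algebra, every linear map from a finite dimensional subspace is a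
combination of modes. -/
theorem IsSimpleVOA.modeSpan_eq_top (hA : A.IsSimpleVOA) (W : Submodule ℂ V)
    [FiniteDimensional ℂ W] : A.modeSpan W = ⊤ := by
  have := hA.isSimpleModule
  rw [eq_top_iff]
  intro φ _
  obtain ⟨ψ, hψ⟩ := φ.exists_extend
  obtain ⟨s, hs⟩ := (Submodule.fg_iff_finiteDimensional W).2 ‹_›
  -- Since the commutant is scalar, any `ℂ`-linear map is linear over it and density applies.
  let f : Module.End (Module.End A.modeAlgebra V) V :=
    { toFun := ψ
      map_add' := ψ.map_add
      map_smul' := fun T v => by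
        obtain ⟨c, hc⟩ := hA.exists_smul_eq T
        simp [hc] }
  obtain ⟨b, hb⟩ := jacobson_density f s
  have h1 := hA.isVOA.modeAlgebra_comp_mem W b.2 _ (hA.isVOA.subtype_mem_modeSpan W)
  convert h1
  rw [← hψ]
  ext ⟨w, hw⟩
  rw [← hs] at hw
  have hle : Submodule.span ℂ (s : Set V) ≤ LinearMap.eqLocus ψ (b : Module.End ℂ V) :=
    Submodule.span_le.2 fun x hx => hb x hx
  exact hle hw

theorem IsSimpleVOA.exists_modes (hA : A.IsSimpleVOA) (W : Submodule ℂ V)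
    [FiniteDimensional ℂ W] (φ : W →ₗ[ℂ] V) :
    ∃ (k : ℕ) (n : Fin k → ℤ) (u : Fin k → V), ∀ w : W, φ w = ∑ j, A.mode (n j) (u j) w := by
  have h : φ ∈ A.modeSpan W := hA.modeSpan_eq_top W ▸ trivial
  obtain ⟨k, c, g, rfl⟩ := Submodule.mem_span_set'.1 h
  choose p hp using fun j => (g j).2
  refine ⟨k, fun j => (p j).1, fun j => c j • (p j).2, fun w => ?_⟩
  simp [← hp]

end Density

/-! ### Density for invariant modes -/

section HopfDensity

variable {V : Type*} [AddCommGroup V] [Module ℂ V] {A : VOAData V}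
variable {H : Type*} [Ring H] [HopfAlgebra ℂ H] [Module H V] [IsScalarTower ℂ H V]

open Coalgebra HopfAlgebra

theorem IsHopfModule.smul_mode_repr (hH : A.IsHopfModule H) {ι : Type*} {h : H}
    (r : Repr ℂ h ι) (n : ℤ) (u v : V) :
    h • A.mode n u v = ∑ i ∈ r.index, A.mode n (r.left i • u) (r.right i • v) := by
  rw [hH.smul_mode, ← r.eq, map_sum]
  rfl

/-- `(h u)ₙ w = ∑ h₁ uₙ (S(h₂) w)`. -/
theorem IsHopfModule.mode_smul_repr (hH : A.IsHopfModule H) {ι : Type*} {h : H}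
    (r : Repr ℂ h ι) (n : ℤ) (u w : V) :
    A.mode n (h • u) w =
      ∑ i ∈ r.index, r.left i • A.mode n u (antipode ℂ (r.right i) • w) := by
  let T : H ⊗[ℂ] (H ⊗[ℂ] H) →ₗ[ℂ] V :=
    TensorProduct.lift ((A.mode n).compl₁₂ (orbitMap H u) (orbitMap H w ∘ₗ
      LinearMap.mul' ℂ H ∘ₗ (antipode ℂ (A := H)).lTensor H))
  have hT : ∀ a b c : H, T (a ⊗ₜ (b ⊗ₜ c)) = A.mode n (a • u) (b • antipode ℂ c • w) := by
    intro a b c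
    simp [T, orbitMap, mul_smul]
  -- Coassociativity groups `h₂` with `S(h₃)`; the antipode axiom then collapses them to the counit.
  have key := congrArg T (sum_tmul_tmul_eq r (fun i => ℛ ℂ (r.left i)) (fun i => ℛ ℂ (r.right i)))
  simp only [map_sum, hT] at key
  simp only [hH.smul_mode_repr (ℛ ℂ (r.left _)), key]
  have h1 : ∀ i, ∑ j ∈ (ℛ ℂ (r.right i)).index,
      A.mode n (r.left i • u) ((ℛ ℂ (r.right i)).left j • antipode ℂ ((ℛ ℂ (r.right i)).right j) • w)
      = A.mode n ((counit (R := ℂ) (r.right i) • r.left i) • u) w := by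
    intro i
    rw [← map_sum]
    simp only [← mul_smul]
    rw [← Finset.sum_smul, sum_mul_antipode_eq_smul]
    simp
  simp only [h1]
  rw [← LinearMap.sum_apply, ← map_sum, ← Finset.sum_smul]
  congr 3
  have h2 := congrArg (TensorProduct.rid ℂ H) (sum_tmul_counit_eq (R := ℂ) r)
  simp only [map_sum, TensorProduct.rid_tmul, one_smul] at h2
  exact h2.symm

/-- Every `H`-linear map from a finite dimensional `H`-submodule of `V` to `V` is a combination of
modes of invariant vectors. -/
theorem IsHopfModule.exists_invariant_modes (hH : A.IsHopfModule H) (hA : A.IsSimpleVOA)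
    [IsSemisimpleModule H V] (W : Submodule H V) [FiniteDimensional ℂ (W.restrictScalars ℂ)]
    (φ : W →ₗ[H] V) :
    ∃ (k : ℕ) (n : Fin k → ℤ) (u : Fin k → invariants V H),
      ∀ w : W, φ w = ∑ j, A.mode (n j) (u j) w := by
  obtain ⟨k, n, u, hu⟩ := hA.exists_modes (W.restrictScalars ℂ) (φ.restrictScalars ℂ)
  have hact : ∀ (h : H) (v : Fin k → V) (w : V),
      ∑ j, A.mode (n j) (h • v j) w =
        ∑ i ∈ (ℛ ℂ h).index, (ℛ ℂ h).left i •
          ∑ j, A.mode (n j) (v j) (antipode ℂ ((ℛ ℂ h).right i) • w) := by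
    intro h v w
    simp only [hH.mode_smul_repr (ℛ ℂ h), Finset.smul_sum]
    exact Finset.sum_comm
  -- The tuples whose mode sum vanishes on `W`; `hact` makes this subspace `H`-stable.
  let K : Submodule H (Fin k → V) :=
    { carrier := {v | ∀ w ∈ W, ∑ j, A.mode (n j) (v j) w = 0}
      add_mem' := fun {a b} ha hb w hw => by
        simp [Finset.sum_add_distrib, ha w hw, hb w hw]
      zero_mem' := fun w _ => by simp
      smul_mem' := fun h v hv w hw => by
        simp only [Pi.smul_apply]
        rw [hact h v w]
        exact Finset.sum_eq_zero fun i _ => by rw [hv _ (W.smul_mem _ hw), smul_zero] }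
  -- Modulo `K` the tuple `u` is invariant: `∑ h₁ φ(S(h₂) w) = ∑ h₁ S(h₂) φ(w) = ε(h) φ(w)`. The
  -- scalar `ε(h)` is written as an element of `H` so that `H`-submodules absorb it directly.
  have huK : ∀ h : H, h • u - (counit (R := ℂ) h • (1 : H)) • u ∈ K := by
    intro h w hw
    have h1 : ∀ h : H, h • φ ⟨w, hw⟩ = ∑ j, A.mode (n j) (u j) (h • w) := by
      intro h
      rw [← map_smul]
      exact hu (h • ⟨w, hw⟩)
    simp only [Pi.sub_apply, Pi.smul_apply, map_sub, LinearMap.sub_apply, Finset.sum_sub_distrib]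
    rw [hact h u w]
    simp only [← h1, ← mul_smul]
    rw [← Finset.sum_smul, sum_mul_antipode_eq_smul, h1]
    simp
  -- The component of `u` in an `H`-stable complement represents the same map, and its defect from
  -- invariance lies in `K ⊓ C = ⊥`.
  obtain ⟨C, hC⟩ := exists_isCompl K
  obtain ⟨a, ha, c, hc, rfl⟩ := Submodule.mem_sup.1
    (show u ∈ K ⊔ C from hC.sup_eq_top ▸ Submodule.mem_top)
  have hcinv : ∀ h : H, h • c = (counit (R := ℂ) h • (1 : H)) • c := by
    intro h
    have h1 : h • c - (counit (R := ℂ) h • (1 : H)) • c ∈ K := by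
      have h2 := sub_mem (huK h) (sub_mem (K.smul_mem h ha)
        (K.smul_mem (counit (R := ℂ) h • (1 : H)) ha))
      convert h2 using 1
      simp only [smul_add]
      abel
    have h3 := hC.disjoint.le_bot ⟨h1, sub_mem (C.smul_mem h hc) (C.smul_mem _ hc)⟩
    exact sub_eq_zero.1 h3
  refine ⟨k, n, fun j => ⟨c j, fun h => ?_⟩, fun w => ?_⟩
  · simpa using congrFun (hcinv h) j
  · have h1 := hu w
    have h2 := ha w w.2
    simp only [Pi.add_apply, map_add, LinearMap.add_apply, Finset.sum_add_distrib] at h1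
    rw [h2, zero_add] at h1
    exact h1

end HopfDensity

/-! ### Projections onto weight spaces -/

section WeightProjection

variable {V : Type*} [AddCommGroup V] [Module ℂ V] {A : VOAData V}

/-- The projection of `V` onto the weight space `V_n`. -/
def IsVOA.weightProj (hA : A.IsVOA) (n : ℤ) : V →ₗ[ℂ] V :=
  letI := hA.grading.chooseDecomposition
  (A.weightSpace A.mode (n : ℂ)).subtype ∘ₗ
    DirectSum.component ℂ ℤ (fun n : ℤ => A.weightSpace A.mode (n : ℂ)) n ∘ₗ
    (DirectSum.decomposeLinearEquiv fun n : ℤ => A.weightSpace A.mode (n : ℂ)).toLinearMap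

theorem IsVOA.weightProj_mem (hA : A.IsVOA) (n : ℤ) (v : V) :
    hA.weightProj n v ∈ A.weightSpace A.mode (n : ℂ) :=
  Subtype.prop _

theorem IsVOA.exists_sum_weightProj (hA : A.IsVOA) (v : V) :
    ∃ s : Finset ℤ, v = ∑ n ∈ s, hA.weightProj n v ∧ ∀ n ∉ s, hA.weightProj n v = 0 := by
  classical
  let := hA.grading.chooseDecomposition
  refine ⟨(DirectSum.decompose (fun n : ℤ => A.weightSpace A.mode (n : ℂ)) v).support,
    (DirectSum.sum_support_decompose _ v).symm, fun n hn => ?_⟩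
  have h0 := DFinsupp.notMem_support_iff.1 hn
  exact congrArg Subtype.val h0

theorem IsVOA.weightProj_of_mem (hA : A.IsVOA) {m : ℤ} {v : V}
    (hv : v ∈ A.weightSpace A.mode (m : ℂ)) (n : ℤ) :
    hA.weightProj n v = if m = n then v else 0 := by
  let := hA.grading.chooseDecomposition
  split_ifs with h
  · subst h
    exact DirectSum.decompose_of_mem_same (fun n : ℤ => A.weightSpace A.mode (n : ℂ)) hv
  · exact DirectSum.decompose_of_mem_ne (fun n : ℤ => A.weightSpace A.mode (n : ℂ)) hv h

theorem IsVOA.weightProj_comm (hA : A.IsVOA) (T : V →ₗ[ℂ] V)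
    (hT : ∀ v, T (A.L A.mode 0 v) = A.L A.mode 0 (T v)) (n : ℤ) (v : V) :
    T (hA.weightProj n v) = hA.weightProj n (T v) := by
  have hv : v ∈ ⨆ m : ℤ, A.weightSpace A.mode (m : ℂ) :=
    hA.grading.submodule_iSup_eq_top ▸ Submodule.mem_top
  induction hv using Submodule.iSup_induction' with
  | mem m x hx =>
    have hTx : T x ∈ A.weightSpace A.mode (m : ℂ) := by
      rw [weightSpace, Module.End.mem_eigenspace_iff] at hx ⊢
      rw [← hT, hx, map_smul]
    rw [hA.weightProj_of_mem hx, hA.weightProj_of_mem hTx]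
    split_ifs <;> simp
  | zero => simp
  | add x y _ _ hx hy => simp [hx, hy]

/-- Projecting `L(0) v = μ v` to weight `n` gives `(n - μ) vₙ = 0`, so a nonzero `v` forces `μ` to
be some `n`. -/
theorem IsVOA.exists_int_eq (hA : A.IsVOA) {μ : ℂ} (h : A.weightSpace A.mode μ ≠ ⊥) :
    ∃ n : ℤ, μ = n := by
  obtain ⟨v, hv, hv0⟩ := Submodule.exists_mem_ne_zero_of_ne_bot h
  obtain ⟨s, hs, -⟩ := hA.exists_sum_weightProj v
  by_contra! hμ
  refine hv0 (hs.trans (Finset.sum_eq_zero fun n _ => ?_))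
  have h1 := hA.weightProj_comm (A.L A.mode 0) (fun _ => rfl) n v
  have h2 := hA.weightProj_mem n v
  rw [weightSpace, Module.End.mem_eigenspace_iff] at hv h2
  rw [h2, hv, map_smul, ← sub_eq_zero, ← sub_smul] at h1
  exact (smul_eq_zero.1 h1).resolve_left (sub_ne_zero.2 (hμ n).symm)

theorem IsVOA.finiteDimensional_weightSpace (hA : A.IsVOA) (μ : ℂ) :
    FiniteDimensional ℂ (A.weightSpace A.mode μ) := by
  by_cases h : A.weightSpace A.mode μ = ⊥
  · rw [h]
    infer_instance
  · obtain ⟨n, rfl⟩ := hA.exists_int_eq h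
    exact hA.finite_dim n

theorem IsVOA.weightSpace_add_eq_bot (hA : A.IsVOA) (μ : ℂ) :
    ∃ K : ℤ, ∀ n : ℤ, n < K → A.weightSpace A.mode (μ + n) = ⊥ := by
  by_cases h : ∃ k : ℤ, μ = k
  · obtain ⟨k, rfl⟩ := h
    obtain ⟨K, hK⟩ := hA.bounded_below
    refine ⟨K - k, fun n hn => ?_⟩
    have := hK (k + n) (by omega)
    push_cast at this
    exact this
  · refine ⟨0, fun n _ => ?_⟩
    by_contra h1
    obtain ⟨m, hm⟩ := hA.exists_int_eq h1
    exact h ⟨m - n, by push_cast; rw [← hm]; ring⟩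

end WeightProjection

/-! ### Descent of the axioms to embedded subspaces -/

section Restriction

variable {V : Type*} [AddCommGroup V] [Module ℂ V]
variable {U : Type*} [AddCommGroup U] [Module ℂ U]
variable {N : Type*} [AddCommGroup N] [Module ℂ N]

/-- `ι` embeds the data `B` into `A` and `e` embeds the space `N`, on which `B` acts by `act`,
equivariantly into `V`. -/
structure IsEmbedding (A : VOAData V) (B : VOAData U) (ι : U →ₗ[ℂ] V)
    (act : ℤ → U →ₗ[ℂ] N →ₗ[ℂ] N) (e : N →ₗ[ℂ] V) : Prop where
  map_mode : ∀ n u v, ι (B.mode n u v) = A.mode n (ι u) (ι v)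
  map_vac : ι B.vac = A.vac
  map_conf : ι B.conf = A.conf
  injective_left : Function.Injective ι
  map_act : ∀ n u w, e (act n u w) = A.mode n (ι u) (e w)
  injective : Function.Injective e

variable {A : VOAData V} {B : VOAData U} {ι : U →ₗ[ℂ] V}
  {act : ℤ → U →ₗ[ℂ] N →ₗ[ℂ] N} {e : N →ₗ[ℂ] V}

namespace IsEmbedding

theorem self (h : IsEmbedding A B ι act e) : IsEmbedding A B ι B.mode ι :=
  { h with map_act := h.map_mode, injective := h.injective_left }

theorem truncated (h : IsEmbedding A B ι act e) (hA : A.IsVOA) : Truncated act := by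
  intro u w
  obtain ⟨K, hK⟩ := hA.truncated (ι u) (e w)
  exact ⟨K, fun n hn => h.injective (by rw [h.map_act, hK n hn, map_zero])⟩

theorem vac_mode (h : IsEmbedding A B ι act e) (hA : A.IsVOA) (n : ℤ) (w : N) :
    act n B.vac w = if n = -1 then w else 0 := by
  apply h.injective
  rw [h.map_act, h.map_vac, hA.vac_mode]
  split_ifs <;> simp

theorem jacobi (h : IsEmbedding A B ι act e) (hA : A.IsVOA) : B.Jacobi act := by
  intro u v w l m n
  obtain ⟨K₁, h₁⟩ := h.truncated hA v w
  obtain ⟨K₂, h₂⟩ := h.truncated hA u w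
  obtain ⟨K₃, h₃⟩ := h.self.truncated hA u v
  obtain ⟨N, hN₁, hN₂, hN₃⟩ : ∃ N : ℕ, K₁ - n ≤ N ∧ K₂ - m ≤ N ∧ K₃ - l ≤ N :=
    ⟨(K₁ - n).toNat + (K₂ - m).toNat + (K₃ - l).toNat, by omega, by omega, by omega⟩
  have a₁ : ∀ i : ℕ, N ≤ i → act (n + i) v w = 0 := fun i hi => h₁ _ (by omega)
  have a₂ : ∀ i : ℕ, N ≤ i → act (m + i) u w = 0 := fun i hi => h₂ _ (by omega)
  have a₃ : ∀ i : ℕ, N ≤ i → B.mode (l + i) u v = 0 := fun i hi => h₃ _ (by omega)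
  have b₁ : ∀ i : ℕ, N ≤ i → A.mode (n + i) (ι v) (e w) = 0 := fun i hi => by
    rw [← h.map_act, a₁ i hi, map_zero]
  have b₂ : ∀ i : ℕ, N ≤ i → A.mode (m + i) (ι u) (e w) = 0 := fun i hi => by
    rw [← h.map_act, a₂ i hi, map_zero]
  have b₃ : ∀ i : ℕ, N ≤ i → A.mode (l + i) (ι u) (ι v) = 0 := fun i hi => by
    rw [← h.map_mode, a₃ i hi, map_zero]
  apply h.injective
  have hj := hA.jacobi (ι u) (ι v) (e w) l m n
  rw [finsum_nat_eq_sum_range (N := N) fun i hi => ?_,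
    finsum_nat_eq_sum_range (N := N) fun i hi => ?_,
    finsum_nat_eq_sum_range (N := N) fun i hi => ?_] at hj ⊢
  · simpa only [map_sub, map_sum, map_smul, h.map_act, h.map_mode] using hj
  all_goals simp [a₁ i hi, a₂ i hi, a₃ i hi, b₁ i hi, b₂ i hi, b₃ i hi]

theorem map_L (h : IsEmbedding A B ι act e) (n : ℤ) (w : N) :
    e (B.L act n w) = A.L A.mode n (e w) := by
  simp only [L, h.map_act, h.map_conf]

theorem mem_weightSpace_iff (h : IsEmbedding A B ι act e) {μ : ℂ} {w : N} :
    w ∈ B.weightSpace act μ ↔ e w ∈ A.weightSpace A.mode μ := by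
  rw [weightSpace, weightSpace, Module.End.mem_eigenspace_iff, Module.End.mem_eigenspace_iff,
    ← h.map_L, ← map_smul, h.injective.eq_iff]

theorem weightSpace_eq_bot (h : IsEmbedding A B ι act e) {μ : ℂ}
    (hμ : A.weightSpace A.mode μ = ⊥) : B.weightSpace act μ = ⊥ := by
  rw [Submodule.eq_bot_iff]
  intro w hw
  rw [h.mem_weightSpace_iff, hμ, Submodule.mem_bot] at hw
  exact h.injective (by rw [hw, map_zero])

theorem finiteDimensional_weightSpace (h : IsEmbedding A B ι act e) (hA : A.IsVOA) (μ : ℂ) :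
    FiniteDimensional ℂ (B.weightSpace act μ) := by
  have := hA.finiteDimensional_weightSpace μ
  exact Module.Finite.of_injective
    (e.restrict fun w hw => h.mem_weightSpace_iff.1 hw :
      B.weightSpace act μ →ₗ[ℂ] A.weightSpace A.mode μ)
    fun x y hxy => Subtype.ext (h.injective (congrArg Subtype.val hxy))

/-- Stability of the image under the weight projections puts the homogeneous components of each
vector back in `N`. -/
theorem iSup_weightSpace (h : IsEmbedding A B ι act e) (hA : A.IsVOA)
    (hP : ∀ n w, ∃ w', e w' = hA.weightProj n (e w)) :
    ⨆ n : ℤ, B.weightSpace act (n : ℂ) = ⊤ := by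
  rw [eq_top_iff]
  intro w _
  choose p hp using fun n => hP n w
  obtain ⟨s, hs, -⟩ := hA.exists_sum_weightProj (e w)
  have hw : w = ∑ n ∈ s, p n := h.injective (by rw [map_sum, hs]; simp [hp])
  rw [hw]
  refine sum_mem fun n _ => Submodule.mem_iSup_of_mem n ?_
  rw [h.mem_weightSpace_iff, hp]
  exact hA.weightProj_mem n _

theorem isVMod (h : IsEmbedding A B ι act e) (hA : A.IsVOA)
    (hP : ∀ n w, ∃ w', e w' = hA.weightProj n (e w)) : B.IsVMod act where
  truncated := h.truncated hA
  vac_mode := h.vac_mode hA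
  jacobi := h.jacobi hA
  grading := by
    refine (DirectSum.isInternal_submodule_iff_iSupIndep_and_iSup_eq_top _).2
      ⟨Module.End.eigenspaces_iSupIndep _, ?_⟩
    rw [eq_top_iff, ← h.iSup_weightSpace hA hP]
    exact iSup_le fun n => le_iSup (fun μ : ℂ => B.weightSpace act μ) (n : ℂ)
  finite_dim := h.finiteDimensional_weightSpace hA
  bounded_below μ := by
    obtain ⟨K, hK⟩ := hA.weightSpace_add_eq_bot μ
    exact ⟨K, fun n hn => h.weightSpace_eq_bot (hK n hn)⟩

theorem isVOA (h : IsEmbedding A B ι B.mode ι) (hA : A.IsVOA)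
    (hP : ∀ n w, ∃ w', ι w' = hA.weightProj n (ι w)) : B.IsVOA where
  grading := (DirectSum.isInternal_submodule_iff_iSupIndep_and_iSup_eq_top _).2
    ⟨(Module.End.eigenspaces_iSupIndep (B.L B.mode 0)).comp Int.cast_injective,
      h.iSup_weightSpace hA hP⟩
  finite_dim n := h.finiteDimensional_weightSpace hA n
  bounded_below := by
    obtain ⟨K, hK⟩ := hA.bounded_below
    exact ⟨K, fun n hn => h.weightSpace_eq_bot (hK n hn)⟩
  vac_mem := by
    rw [h.mem_weightSpace_iff, h.map_vac]
    exact hA.vac_mem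
  conf_mem := by
    rw [h.mem_weightSpace_iff, h.map_conf]
    exact hA.conf_mem
  truncated := h.truncated hA
  vac_mode := h.vac_mode hA
  creation v := h.injective (by rw [h.map_mode, h.map_vac, hA.creation])
  creation_nonneg n v hn := h.injective (by
    rw [h.map_mode, h.map_vac, hA.creation_nonneg n _ hn, map_zero])
  derivative n v := by
    ext w
    apply h.injective
    rw [h.map_mode, h.map_L, hA.derivative]
    simp [h.map_mode]
  virasoro := by
    obtain ⟨c, hc⟩ := hA.virasoro
    refine ⟨c, fun m n => ?_⟩
    ext w
    apply h.injective
    have h1 := LinearMap.congr_fun (hc m n) (ι w)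
    simp only [LinearMap.sub_apply, LinearMap.add_apply, LinearMap.smul_apply,
      Module.End.mul_apply, Module.End.one_apply] at h1
    simpa only [LinearMap.sub_apply, LinearMap.add_apply, LinearMap.smul_apply,
      Module.End.mul_apply, Module.End.one_apply, map_sub, map_add, map_smul, h.map_L] using h1
  jacobi := h.jacobi hA

end IsEmbedding

end Restriction

/-! ### The isotypic decomposition -/

section Decomposition

variable {H V : Type*} [Ring H] [HopfAlgebra ℂ H] [AddCommGroup V] [Module ℂ V] [Module H V]
  [IsScalarTower ℂ H V]

/-- The set of isotypic components is always independent. For the indexed family it remains to see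
that distinct indices give distinct components, which is pairwise inequivalence. -/
theorem IsSimpleFamily.iSupIndep_isotypicComponent {H V : Type*} [Ring H] [AddCommGroup V]
    [Module H V] {I : Type*} {M : I → Type*} [∀ i, AddCommGroup (M i)] [∀ i, Module H (M i)]
    (hM : IsSimpleFamily H V M) : iSupIndep fun i => isotypicComponent H V (M i) := by
  have := hM.simple
  choose f hf using hM.occurs
  let e i := LinearEquiv.ofInjective (f i) (hf i)
  have hs : ∀ i, IsSimpleModule H (LinearMap.range (f i)) := fun i => .congr (e i).symm
  let φ : I → isotypicComponents H V := fun i =>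
    ⟨isotypicComponent H V (M i), LinearMap.range (f i), hs i, (e i).isotypicComponent_eq⟩
  refine ((sSupIndep_iff _).1 (sSupIndep_isotypicComponents (R := H) (M := V))).comp (f := φ) ?_
  intro i j hij
  have hle : LinearMap.range (f i) ≤ isotypicComponent H V (M j) := by
    rw [← show isotypicComponent H V (M i) = isotypicComponent H V (M j) from
      congrArg Subtype.val hij]
    exact le_sSup ⟨(e i).symm⟩
  obtain ⟨e'⟩ := isIsotypicOfType_submodule_iff.1 (.isotypicComponent H V (M j)) _ hle
  exact hM.inequivalent i j ⟨(e i).trans e'⟩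

/-- Evaluation of `H`-homomorphisms at tensors is injective for a finite dimensional simple
`H`-module. -/
theorem eq_zero_of_lift_apply_eq_zero {M : Type*} [AddCommGroup M] [Module ℂ M] [Module H M]
    [IsScalarTower ℂ H M] [IsSimpleModule H M] [FiniteDimensional ℂ M]
    (ev : M ⊗[ℂ] (M →ₗ[H] V) →ₗ[ℂ] V) (hev : ∀ x f, ev (x ⊗ₜ f) = f x)
    {t : M ⊗[ℂ] (M →ₗ[H] V)} (ht : ev t = 0) : t = 0 := by
  classical
  set b := Module.finBasis ℂ M with hb
  obtain ⟨c, rfl⟩ := TensorProduct.eq_repr_basis_left b t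
  suffices hc : c = 0 by simp [hc]
  ext1 k
  let T : M →ₗ[ℂ] M := b.constr ℂ fun j => if j = k then b j else 0
  -- By Schur, `End_H(M) = ℂ`, so density yields `h` in `H` acting as the projection onto the line
  -- of `b k`. Applying it to `∑ c j (b j) = 0` isolates `c k (b k) = 0`; a map from a simple module
  -- killing `b k ≠ 0` is zero.
  let F : Module.End (Module.End H M) M :=
    { toFun := T
      map_add' := T.map_add
      map_smul' := fun g x => by
        obtain ⟨z, rfl⟩ :=
          (IsSimpleModule.algebraMap_end_bijective_of_isAlgClosed (A := H) (V := M) ℂ).2 g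
        simp }
  obtain ⟨h, hh⟩ := jacobson_density F (Finset.univ.image b)
  have hh' : ∀ j, h • b j = if j = k then b j else 0 := by
    intro j
    rw [← hh (b j) (Finset.mem_image_of_mem b (Finset.mem_univ j))]
    exact b.constr_basis ℂ _ j
  have h0 : (c k) (b k) = 0 := by
    have h1 := congrArg (h • ·) ht
    simp only [Finsupp.sum, map_sum, hev, Finset.smul_sum, smul_zero, ← map_smul, hh'] at h1
    rw [Finset.sum_eq_single k] at h1
    · simpa using h1
    · intro j _ hj
      simp [hj]
    · intro hk
      simp [Finsupp.notMem_support_iff.1 hk]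
  refine (LinearMap.injective_or_eq_zero (c k)).resolve_left fun hinj => b.ne_zero k (hinj ?_)
  rw [h0, map_zero]

variable {I : Type*} {M : I → Type*} [∀ i, AddCommGroup (M i)] [∀ i, Module ℂ (M i)]
    [∀ i, Module H (M i)] [∀ i, IsScalarTower ℂ H (M i)]

open Classical in
theorem decompMap_lof_tmul (i : I) (x : M i) (f : M i →ₗ[H] V) :
    decompMap H V M (DirectSum.lof ℂ I (fun i => M i ⊗[ℂ] (M i →ₗ[H] V)) i (x ⊗ₜ f)) = f x := by
  rw [decompMap, DirectSum.toModule_lof]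
  rfl

theorem decompMap_injective (hM : IsSimpleFamily H V M) (hfin : ∀ i, FiniteDimensional ℂ (M i)) :
    Function.Injective (decompMap H V M) := by
  classical
  have := hM.simple
  rw [injective_iff_map_eq_zero]
  intro t ht
  let ev i := decompMap H V M ∘ₗ DirectSum.lof ℂ I (fun i => M i ⊗[ℂ] (M i →ₗ[H] V)) i
  have hev : ∀ i x f, ev i (x ⊗ₜ f) = f x := fun i x f => by
    simpa [ev] using decompMap_lof_tmul i x f
  have hmem : ∀ i s, ev i s ∈ isotypicComponent H V (M i) := by
    intro i s
    induction s with
    | zero => simp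
    | tmul x f =>
      rw [hev]
      rcases f.injective_or_eq_zero with hf | hf
      · exact (le_sSup ⟨(LinearEquiv.ofInjective f hf).symm⟩ :
          LinearMap.range f ≤ isotypicComponent H V (M i)) ⟨x, rfl⟩
      · simp [hf]
    | add x y hx hy =>
      rw [map_add]
      exact add_mem hx hy
  have hsum : ∑ i ∈ DFinsupp.support t, ev i (t i) = 0 := by
    rw [← ht]
    conv_rhs => rw [← DirectSum.sum_support_of t, map_sum]
    rfl
  have hz := (iSupIndep_iff_finsetSum_eq_zero_imp_eq_zero _).1 hM.iSupIndep_isotypicComponent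
    (DFinsupp.support t) (fun i => ev i (t i)) (fun i _ => hmem i _) hsum
  ext1 i
  by_cases hi : i ∈ DFinsupp.support t
  · exact eq_zero_of_lift_apply_eq_zero (ev i) (hev i) (hz i hi)
  · exact DFinsupp.notMem_support_iff.1 hi

theorem decompMap_surjective [IsSemisimpleModule H V] (hM : IsSimpleFamily H V M) :
    Function.Surjective (decompMap H V M) := by
  classical
  intro v
  have hv : v ∈ ⨆ S : {S : Submodule H V | IsSimpleModule H S}, (S : Submodule H V) := by
    rw [← sSup_eq_iSup', IsSemisimpleModule.sSup_simples_eq_top]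
    trivial
  induction hv using Submodule.iSup_induction' with
  | mem S x hx =>
    obtain ⟨i, ⟨e⟩⟩ := hM.complete S S.2
    exact ⟨_, (decompMap_lof_tmul i (e ⟨x, hx⟩) ((S : Submodule H V).subtype ∘ₗ e.symm)).trans
      (by simp)⟩
  | zero => exact ⟨0, map_zero _⟩
  | add x y _ _ hx hy =>
    obtain ⟨a, rfl⟩ := hx
    obtain ⟨b, rfl⟩ := hy
    exact ⟨a + b, map_add _ a b⟩

end Decomposition

/-! ### Simplicity and inequivalence over the fixed point VOA -/

section FixedPoints

variable {H V : Type*} [Ring H] [HopfAlgebra ℂ H] [AddCommGroup V] [Module ℂ V] [Module H V]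
  [IsScalarTower ℂ H V] {A : VOAData V}

/-- The projections onto the weight spaces are `H`-linear. -/
def IsHopfModule.weightProj (hH : A.IsHopfModule H) (hA : A.IsVOA) (n : ℤ) : V →ₗ[H] V where
  toFun := hA.weightProj n
  map_add' := map_add _
  map_smul' h v := by
    -- `L(0)` is a mode of the invariant vector `ω`, hence commutes with `H`.
    exact (hA.weightProj_comm (DistribSMul.toLinearMap ℂ V h)
      (hH.smul_mode_invariant (fun h => hH.smul_conf h) h _) n v).symm

variable {M : Type*} [AddCommGroup M] [Module H M]

/-- Some weight projection is nonzero on the image of `f`; being `H`-linear on a simple module, it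
embeds `M` in a finite dimensional weight space. -/
theorem IsHopfModule.finiteDimensional_of_injective [Module ℂ M] [IsScalarTower ℂ H M]
    [IsSimpleModule H M] (hH : A.IsHopfModule H) (hA : A.IsVOA) (f : M →ₗ[H] V)
    (hf : Function.Injective f) : FiniteDimensional ℂ M := by
  have := IsSimpleModule.nontrivial H M
  obtain ⟨x, hx⟩ := exists_ne (0 : M)
  obtain ⟨n, hn⟩ : ∃ n, hA.weightProj n (f x) ≠ 0 := by
    by_contra! h
    obtain ⟨s, hs, -⟩ := hA.exists_sum_weightProj (f x)
    simp only [h, Finset.sum_const_zero] at hs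
    exact hx (hf (by rw [hs, map_zero]))
  let g : M →ₗ[H] V := hH.weightProj hA n ∘ₗ f
  have hg : Function.Injective g := LinearMap.injective_of_ne_zero fun h =>
    hn (LinearMap.congr_fun h x)
  have := hA.finite_dim n
  exact Module.Finite.of_injective ((g.restrictScalars ℂ).codRestrict
    (A.weightSpace A.mode (n : ℂ)) fun y => hA.weightProj_mem n (f y))
    fun y z hyz => hg (congrArg Subtype.val hyz)

theorem isEmbedding_fixedVOA (hH : A.IsHopfModule H) (hA : A.IsVOA) :
    IsEmbedding A (A.fixedVOA H hA hH) (invariants V H).subtype (A.fixedVOA H hA hH).mode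
      (invariants V H).subtype where
  map_mode _ _ _ := rfl
  map_vac := rfl
  map_conf := rfl
  injective_left := Subtype.val_injective
  map_act _ _ _ := rfl
  injective := Subtype.val_injective

variable (V) in
/-- Evaluation of `H`-homomorphisms `M → V` at `x`. -/
def evalAt (x : M) : (M →ₗ[H] V) →ₗ[ℂ] V where
  toFun f := f x
  map_add' _ _ := rfl
  map_smul' _ _ := rfl

/-- A nonzero `x` generates the simple module `M`, so an `H`-homomorphism is determined by its value
at `x`. -/
theorem isEmbedding_multAct [IsSimpleModule H M] (hH : A.IsHopfModule H) (hA : A.IsVOA)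
    {x : M} (hx : x ≠ 0) :
    IsEmbedding A (A.fixedVOA H hA hH) (invariants V H).subtype (A.multAct M hH)
      (evalAt (H := H) V x) where
  map_mode _ _ _ := rfl
  map_vac := rfl
  map_conf := rfl
  injective_left := Subtype.val_injective
  map_act _ _ _ := rfl
  injective f g hfg := by
    ext y
    obtain ⟨h, rfl⟩ := IsSimpleModule.toSpanSingleton_surjective H hx y
    have : f x = g x := hfg
    simp [this]

theorem fixedVOA_isVOA (hH : A.IsHopfModule H) (hA : A.IsVOA) : (A.fixedVOA H hA hH).IsVOA :=
  (isEmbedding_fixedVOA hH hA).isVOA hA fun n w =>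
    ⟨⟨hH.weightProj hA n w, fun h => by
      rw [← map_smul, w.2 h]
      exact (hA.weightProj n).map_smul _ _⟩, rfl⟩

theorem multAct_isVMod [IsSimpleModule H M] (hH : A.IsHopfModule H) (hA : A.IsVOA) :
    (A.fixedVOA H hA hH).IsVMod (A.multAct M hH) := by
  have := IsSimpleModule.nontrivial H M
  obtain ⟨x, hx⟩ := exists_ne (0 : M)
  exact (isEmbedding_multAct hH hA hx).isVMod hA fun n f => ⟨hH.weightProj hA n ∘ₗ f, rfl⟩

theorem fixedVOA_isSimpleVOA [IsSemisimpleModule H V] (hH : A.IsHopfModule H)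
    (hA : A.IsSimpleVOA) : (A.fixedVOA H hA.isVOA hH).IsSimpleVOA := by
  refine ⟨fixedVOA_isVOA hH hA.isVOA, ?_, fun S hS => ?_⟩
  · have := hA.irreducible.1
    obtain ⟨v, hv⟩ := exists_ne (0 : V)
    refine ⟨(A.fixedVOA H hA.isVOA hH).vac, 0, fun h => hv ?_⟩
    have h0 : A.vac = 0 := congrArg Subtype.val h
    rw [← hA.isVOA.creation v, h0, map_zero]
  · rw [or_iff_not_imp_left]
    intro hne
    obtain ⟨w, hw, hw0⟩ := Submodule.exists_mem_ne_zero_of_ne_bot hne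
    rw [eq_top_iff]
    intro w' _
    have hwv : (w : V) ≠ 0 := fun h => hw0 (Subtype.ext h)
    -- As `w` is invariant, `W` is the line `ℂ w`, and sending `w` to `w'` is `H`-linear because
    -- both are invariant.
    let W : Submodule H V := Submodule.span H {(w : V)}
    have hspan : ∀ y ∈ W, ∃ c : ℂ, y = c • (w : V) := by
      intro y hy
      obtain ⟨h, rfl⟩ := Submodule.mem_span_singleton.1 hy
      exact ⟨_, w.2 h⟩
    have : FiniteDimensional ℂ (W.restrictScalars ℂ) := by
      refine Submodule.finiteDimensional_of_le (S₂ := Submodule.span ℂ {(w : V)}) fun y hy => ?_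
      obtain ⟨c, rfl⟩ := hspan y hy
      exact Submodule.smul_mem _ _ (Submodule.mem_span_singleton_self _)
    obtain ⟨ℓ, hℓ⟩ := Module.Projective.exists_dual_eq_one ℂ hwv
    let φ : W →ₗ[H] V :=
      { toFun := fun y => ℓ y • (w' : V)
        map_add' := fun y z => by simp [add_smul]
        map_smul' := fun h y => by
          obtain ⟨c, hc⟩ := hspan y y.2
          have h1 : h • (y : V) = Coalgebra.counit (R := ℂ) h • (y : V) := by
            rw [hc, smul_comm, w.2 h, smul_comm]
          rw [Submodule.coe_smul, h1, map_smul, RingHom.id_apply, smul_comm h, w'.2 h, smul_assoc,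
            smul_comm] }
    obtain ⟨k, n, u, hu⟩ := hH.exists_invariant_modes hA W φ
    have h1 := hu ⟨w, Submodule.mem_span_singleton_self _⟩
    have h2 : w' = ∑ j, (A.fixedVOA H hA.isVOA hH).mode (n j) (u j) w := by
      ext
      simp only [φ, LinearMap.coe_mk, AddHom.coe_mk, hℓ, one_smul] at h1
      rw [h1, AddSubmonoidClass.coe_finsetSum]
      rfl
    rw [h2]
    exact sum_mem fun j _ => hS _ _ _ hw

/-- If `f` is an injective `H`-linear map from a finite dimensional `H`-module to `V`, every
`H`-linear map `g` to `V` is `f` followed by a combination of modes of invariant vectors. -/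
theorem IsHopfModule.exists_modes_comp_eq [Module ℂ M] [IsScalarTower ℂ H M] [FiniteDimensional ℂ M]
    [IsSemisimpleModule H V] (hH : A.IsHopfModule H) (hA : A.IsSimpleVOA) (f g : M →ₗ[H] V)
    (hf : Function.Injective f) :
    ∃ (k : ℕ) (n : Fin k → ℤ) (u : Fin k → invariants V H),
      ∀ x, g x = ∑ j, A.mode (n j) (u j) (f x) := by
  have : FiniteDimensional ℂ ((LinearMap.range f).restrictScalars ℂ) :=
    inferInstanceAs (FiniteDimensional ℂ (LinearMap.range (f.restrictScalars ℂ)))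
  obtain ⟨k, n, u, hu⟩ := hH.exists_invariant_modes hA (LinearMap.range f)
    (g ∘ₗ (LinearEquiv.ofInjective f hf).symm)
  refine ⟨k, n, u, fun x => ?_⟩
  simpa using hu (LinearEquiv.ofInjective f hf x)

theorem multAct_isIrreducible [IsSemisimpleModule H V] [Module ℂ M] [IsScalarTower ℂ H M]
    [IsSimpleModule H M] [FiniteDimensional ℂ M] (hH : A.IsHopfModule H) (hA : A.IsSimpleVOA)
    (hM : ∃ f : M →ₗ[H] V, Function.Injective f) : IsIrreducible (A.multAct M hH) := by
  have := IsSimpleModule.nontrivial H M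
  refine ⟨?_, fun S hS => ?_⟩
  · obtain ⟨f, hf⟩ := hM
    obtain ⟨x, hx⟩ := exists_ne (0 : M)
    refine ⟨f, 0, fun h => hx (hf ?_)⟩
    simp [h]
  · rw [or_iff_not_imp_left]
    intro hne
    obtain ⟨f, hf, hf0⟩ := Submodule.exists_mem_ne_zero_of_ne_bot hne
    rw [eq_top_iff]
    intro g _
    obtain ⟨k, n, u, hu⟩ := hH.exists_modes_comp_eq hA f g (f.injective_of_ne_zero hf0)
    have h2 : g = ∑ j, A.multAct M hH (n j) (u j) f := by
      ext x
      rw [hu x, LinearMap.sum_apply]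
      rfl
    rw [h2]
    exact sum_mem fun j _ => hS _ _ _ hf

/-- If `M` and `N` were not isomorphic, the images of `f` and `e f` would be independent, so one
combination of invariant modes could fix `f` and kill `e f`. Equivariance of `e` then forces `e f =
0`. -/
theorem nonempty_equiv_of_modIso [IsSemisimpleModule H V] [Module ℂ M] [IsScalarTower ℂ H M]
    [IsSimpleModule H M] [FiniteDimensional ℂ M] {N : Type*} [AddCommGroup N] [Module H N]
    [Module ℂ N] [IsScalarTower ℂ H N] [IsSimpleModule H N] [FiniteDimensional ℂ N]
    (hH : A.IsHopfModule H) (hA : A.IsSimpleVOA) (hM : ∃ f : M →ₗ[H] V, Function.Injective f)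
    (hiso : ModIso (A.multAct M hH) (A.multAct N hH)) : Nonempty (M ≃ₗ[H] N) := by
  have := IsSimpleModule.nontrivial H M
  obtain ⟨f, hf⟩ := hM
  obtain ⟨e, he⟩ := hiso
  have hf0 : f ≠ 0 := by
    rintro rfl
    obtain ⟨x, hx⟩ := exists_ne (0 : M)
    exact hx (hf rfl)
  have hg : Function.Injective (e f) :=
    LinearMap.injective_of_ne_zero ((map_ne_zero_iff e e.injective).2 hf0)
  let eM := LinearEquiv.ofInjective f hf
  let eN := LinearEquiv.ofInjective (e f) hg
  have hsM : IsSimpleModule H (LinearMap.range f) := .congr eM.symm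
  have hsN : IsSimpleModule H (LinearMap.range (e f)) := .congr eN.symm
  by_contra hMN
  -- Both ranges are atoms of the submodule lattice, so they are equal or disjoint.
  have hdisj : Disjoint (LinearMap.range f) (LinearMap.range (e f)) := by
    refine (IsSimpleModule.isAtom).disjoint_of_ne (IsSimpleModule.isAtom) fun heq => hMN ?_
    exact ⟨eM.trans ((LinearEquiv.ofEq _ _ heq).trans eN.symm)⟩
  have hinj : Function.Injective (f.coprod (e f)) := by
    rw [← LinearMap.ker_eq_bot, LinearMap.ker_coprod_of_disjoint_range _ _ hdisj,
      LinearMap.ker_eq_bot.2 hf, LinearMap.ker_eq_bot.2 hg, Submodule.prod_bot]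
  obtain ⟨k, n, u, hu⟩ := hH.exists_modes_comp_eq hA (f.coprod (e f)) (f.coprod 0) hinj
  have h1 : f = ∑ j, A.multAct M hH (n j) (u j) f := by
    ext x
    have h := hu (x, 0)
    simp only [LinearMap.coprod_apply, map_zero, add_zero] at h
    rw [LinearMap.sum_apply]
    exact h
  have h2 : 0 = ∑ j, A.multAct N hH (n j) (u j) (e f) := by
    ext y
    have h := hu (0, y)
    simp only [LinearMap.coprod_apply, map_zero, zero_add] at h
    rw [LinearMap.sum_apply]
    exact h
  simp only [← he] at h2
  rw [← map_sum, ← h1] at h2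
  exact hf0 (e.map_eq_zero_iff.1 h2.symm)

end FixedPoints

end VOAData

end

theorem theorem3p8 {H V : Type*} [Ring H] [HopfAlgebra ℂ H]
    [AddCommGroup V] [Module ℂ V] [Module H V] [IsScalarTower ℂ H V]
    (A : VOAData V) (hA : A.IsSimpleVOA) (hH : A.IsHopfModule H) (hss : IsSemisimpleModule H V)
    {I : Type*} (M : I → Type*) [∀ i, AddCommGroup (M i)] [∀ i, Module ℂ (M i)]
    [∀ i, Module H (M i)] [∀ i, IsScalarTower ℂ H (M i)]
    (hM : VOAData.IsSimpleFamily H V M) :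
    Function.Bijective (VOAData.decompMap H V M) ∧
    (A.fixedVOA H hA.isVOA hH).IsSimpleVOA ∧
    (∀ i, (A.fixedVOA H hA.isVOA hH).IsVMod (A.multAct (M i) hH) ∧
      VOAData.IsIrreducible (A.multAct (M i) hH)) ∧
    (∀ i j, VOAData.ModIso (A.multAct (M i) hH) (A.multAct (M j) hH) ↔ i = j) := by
  have hsimple := hM.simple
  have hfin : ∀ i, FiniteDimensional ℂ (M i) := fun i => by
    obtain ⟨f, hf⟩ := hM.occurs i
    exact hH.finiteDimensional_of_injective hA.isVOA f hf
  refine ⟨⟨VOAData.decompMap_injective hM hfin, VOAData.decompMap_surjective hM⟩,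
    VOAData.fixedVOA_isSimpleVOA hH hA, fun i => ⟨VOAData.multAct_isVMod hH hA.isVOA,
      VOAData.multAct_isIrreducible hH hA (hM.occurs i)⟩, fun i j => ⟨fun h => ?_, ?_⟩⟩
  · exact hM.inequivalent i j (VOAData.nonempty_equiv_of_modIso hH hA (hM.occurs i) h)
  · rintro rfl
    exact ⟨LinearEquiv.refl ℂ _, fun _ _ _ => rfl⟩
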